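/- Let $(\Omega,\mathcal F,P)$ be a probability space and $L^0$ the space of real random variables modulo almost sure equality, with the almost sure order and the topology of convergence in probability. Let $\mathcal X\subset L^0$ be a linear subspace with a topology such that either $\mathcal X=L^\infty$ with the weak-star topology $\sigma(L^\infty,L^1)$, or $\mathcal X$ is a Fréchet lattice (a completely metrizable locally solid Riesz space for the almost sure order) for which * $X_n\downarrow 0$ a.s. with $X_n\in\mathcal X$ implies $X_n\to 0$ in $\mathcal X$, and * the inclusions $L^\infty\subset\mathcal X\subset L^0$ hold, are continuous and have dense range, where $L^\infty$ carries the sup-norm. Assume moreover that $\mathcal X$ is an $L^\infty$-module, i.e. $RX\in\mathcal X$ for all $R\in L^\infty$ and $X\in\mathcal X$. An acceptance set is a nonempty proper subset $\mathcal A\subsetneq\mathcal X$ such that $X\in\mathcal A$, $Y\in\mathcal X$ and $Y\ge X$ imply $Y\in\mathcal A$. It is called numéraire invariant if $RX\in\mathcal A$ for every $X\in\mathcal A$ and every $R\in L^\infty$ with $R>0$ almost surely. For $A\in\mathcal F$ put $\mathcal X(A)=\{1_AX : X\in\mathcal X\}$ and $\mathcal X_+(A)=\{Y\in\mathcal X(A)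 : Y\ge 0\}$. **Theorem.** Let $\mathcal A\subset\mathcal X$ be a closed, convex acceptance set. Then $\mathcal A$ is numéraire invariant if and only if there exists $A\in\mathcal F$ with $P(A)>0$ such that $$\mathcal A=\mathcal X_+(A)\oplus\mathcal X(A^c),$$ i.e. $\mathcal A$ is the set of all sums $Y+Z$ with $Y\in\mathcal X_+(A)$ and $Z\in\mathcal X(A^c)$, and $Y,Z$ are uniquely determined by $Y+Z$. -/

import Mathlib

open MeasureTheory Filter Topology
open scoped ENNReal Pointwise

namespace CapitalAdequacy

noncomputable section

section Spaces

variable {Ω : Type*} [MeasurableSpace Ω] (P : Measure Ω)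

/-- `L⁰(Ω, F, P)`: real random variables, identified when they coincide almost surely. -/
abbrev LZero : Type _ := Ω →ₘ[P] ℝ

/-- `L^∞(Ω, F, P)` as a linear subspace of `L⁰`. -/
abbrev LInfty : Submodule ℝ (LZero P) := Lp.LpSubmodule ℝ ℝ ∞ P

theorem integrable_min_one_abs_sub [IsProbabilityMeasure P] (X Y : LZero P) :
    Integrable (fun ω => min 1 |X ω - Y ω|) P := by
  refine Integrable.mono' (integrable_const (1 : ℝ)) ?_ ?_
  · exact (continuous_const.min continuous_id.abs).comp_aestronglyMeasurable
      (X.aestronglyMeasurable.sub Y.aestronglyMeasurable)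
  · refine Eventually.of_forall fun ω => ?_
    rw [Real.norm_eq_abs, abs_of_nonneg (le_min zero_le_one (abs_nonneg _))]
    exact min_le_left _ _

/-- The metric `d(X, Y) = E[min(1, |X - Y|)]` on `L⁰`, which metrizes convergence in
probability. -/
@[reducible] def probabilityMetric [IsProbabilityMeasure P] : PseudoMetricSpace (LZero P) where
  dist X Y := ∫ ω, min 1 |X ω - Y ω| ∂P
  dist_self X := by simp
  dist_comm X Y := by simp only [abs_sub_comm]
  dist_triangle X Y Z := by
    rw [← integral_add (integrable_min_one_abs_sub P X Y) (integrable_min_one_abs_sub P Y Z)]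
    refine integral_mono (integrable_min_one_abs_sub P X Z)
      ((integrable_min_one_abs_sub P X Y).add (integrable_min_one_abs_sub P Y Z)) fun ω => ?_
    have h := abs_sub_le (X ω) (Y ω) (Z ω)
    have h1 := abs_nonneg (X ω - Y ω)
    have h2 := abs_nonneg (Y ω - Z ω)
    change min 1 |X ω - Z ω| ≤ min 1 |X ω - Y ω| + min 1 |Y ω - Z ω|
    rcases min_cases 1 |X ω - Y ω| with h3 | h3 <;>
      rcases min_cases 1 |Y ω - Z ω| with h4 | h4 <;>
      rcases min_cases 1 |X ω - Z ω| with h5 | h5 <;> linarith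

/-- The topology of convergence in probability on `L⁰`. -/
@[reducible] def probabilityTopology [IsProbabilityMeasure P] : TopologicalSpace (LZero P) :=
  (probabilityMetric P).toUniformSpace.toTopologicalSpace

variable {P}

/-- The topology generated on `𝒳` by the functionals `X ↦ E[XZ]`, `Z ∈ L¹`. For `𝒳 = L^∞` this
is the weak-star topology `σ(L^∞, L¹)`. (It is used only for `𝒳 = L^∞`, where all the products
`XZ` are integrable.) -/
@[reducible] def weakStarTopology (𝒳 : Submodule ℝ (LZero P)) : TopologicalSpace 𝒳 :=
  TopologicalSpace.induced
    (fun (X : 𝒳) (Z : Lp ℝ 1 P) => ∫ ω, (X : LZero P) ω * (Z : LZero P) ω ∂P)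
    Pi.topologicalSpace

/-- `𝒳` with its topology is a completely metrizable, locally solid Riesz space for the almost
sure order of `L⁰`, satisfies the `σ`-Lebesgue property, and has the continuous dense embeddings
`L^∞ ↪ 𝒳 ↪ L⁰`, for the sup-norm on `L^∞` and convergence in probability on `L⁰`. -/
structure IsFrechetLatticeSpace [IsProbabilityMeasure P] (𝒳 : Submodule ℝ (LZero P))
    [TopologicalSpace 𝒳] : Prop where
  isTopologicalAddGroup : IsTopologicalAddGroup 𝒳
  continuousSMul : ContinuousSMul ℝ 𝒳
  completelyMetrizable : TopologicalSpace.IsCompletelyMetrizableSpace 𝒳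
  sup_mem : ∀ X ∈ 𝒳, ∀ Y ∈ 𝒳, X ⊔ Y ∈ 𝒳
  /-- Every neighbourhood of zero contains a solid neighbourhood of zero. -/
  locallySolid : ∀ U ∈ 𝓝 (0 : 𝒳), ∃ V ∈ 𝓝 (0 : 𝒳), V ⊆ U ∧
    ∀ X ∈ V, ∀ Y : 𝒳, |(Y : LZero P)| ≤ |(X : LZero P)| → Y ∈ V
  sigmaLebesgue : ∀ X : ℕ → 𝒳, (∀ n, (X (n + 1) : LZero P) ≤ (X n : LZero P)) →
    (∀ᵐ ω ∂P, Tendsto (fun n => (X n : LZero P) ω) atTop (𝓝 0)) → Tendsto X atTop (𝓝 0)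
  lInfty_le : LInfty P ≤ 𝒳
  continuous_embedding : Continuous
    (fun X : Lp ℝ ∞ P => (⟨(X : LZero P), lInfty_le X.2⟩ : 𝒳))
  dense_embedding : DenseRange
    (fun X : Lp ℝ ∞ P => (⟨(X : LZero P), lInfty_le X.2⟩ : 𝒳))
  continuous_coe : @Continuous 𝒳 (LZero P) _ (probabilityTopology P) (fun X : 𝒳 => (X : LZero P))
  dense_coe : @DenseRange (LZero P) (probabilityTopology P) 𝒳 (fun X : 𝒳 => (X : LZero P))

/-- The admissible ambient spaces: either `L^∞` with the topology `σ(L^∞, L¹)`, or a linear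
subspace of `L⁰` of the kind described in `IsFrechetLatticeSpace`. -/
def IsAmbientSpace [IsProbabilityMeasure P] (𝒳 : Submodule ℝ (LZero P))
    [τ : TopologicalSpace 𝒳] : Prop :=
  (𝒳 = LInfty P ∧ τ = weakStarTopology 𝒳) ∨ IsFrechetLatticeSpace 𝒳

/-- `𝒳` is an `L^∞`-module: `R ∈ L^∞` and `X ∈ 𝒳` imply `RX ∈ 𝒳`. -/
def IsLInftyModule (𝒳 : Submodule ℝ (LZero P)) : Prop :=
  ∀ R ∈ LInfty P, ∀ X ∈ 𝒳, R * X ∈ 𝒳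

/-- An acceptance set in `𝒳`: a nonempty, strict, monotone subset. -/
structure IsAcceptanceSet {𝒳 : Submodule ℝ (LZero P)} (𝒜 : Set 𝒳) : Prop where
  nonempty : 𝒜.Nonempty
  ne_univ : 𝒜 ≠ Set.univ
  monotone : ∀ X ∈ 𝒜, ∀ Y : 𝒳, (X : LZero P) ≤ (Y : LZero P) → Y ∈ 𝒜

/-- `R` is a rescaling factor: `R ∈ L^∞` and `R > 0` almost surely. -/
def IsRescalingFactor (R : LZero P) : Prop :=
  R ∈ LInfty P ∧ ∀ᵐ ω ∂P, 0 < R ω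

/-- Numéraire invariance: `RX ∈ 𝒜` for all `X ∈ 𝒜` and all rescaling factors `R`. -/
def IsNumeraireInvariant {𝒳 : Submodule ℝ (LZero P)} (h𝒳 : IsLInftyModule 𝒳)
    (𝒜 : Set 𝒳) : Prop :=
  ∀ (R : LZero P) (hR : IsRescalingFactor R), ∀ X ∈ 𝒜,
    (⟨R * (X : LZero P), h𝒳 R hR.1 X X.2⟩ : 𝒳) ∈ 𝒜

variable (P) in
/-- The indicator random variable `1_A` of a measurable set `A`. -/
def ind {A : Set Ω} (hA : MeasurableSet A) : LZero P :=
  AEEqFun.mk (A.indicator fun _ => (1 : ℝ))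
    (stronglyMeasurable_const.indicator hA).aestronglyMeasurable

/-- `𝒳(A) = 1_A 𝒳`, as a subset of `𝒳`. -/
def restrict (𝒳 : Submodule ℝ (LZero P)) {A : Set Ω} (hA : MeasurableSet A) : Set 𝒳 :=
  {Y | ∃ X : 𝒳, (Y : LZero P) = ind P hA * (X : LZero P)}

/-- `𝒳₊(A) = 𝒳(A) ∩ 𝒳₊`. -/
def restrictPos (𝒳 : Submodule ℝ (LZero P)) {A : Set Ω} (hA : MeasurableSet A) : Set 𝒳 :=
  {Y | Y ∈ restrict 𝒳 hA ∧ 0 ≤ (Y : LZero P)}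

end Spaces

/-- `S = T ⊕ U` for subsets of a vector space: `S` is the Minkowski sum of `T` and `U`, and the
decomposition of an element of `S` as a sum is unique. -/
def IsDirectSum {V : Type*} [AddCommGroup V] (S T U : Set V) : Prop :=
  S = T + U ∧ ∀ t ∈ T, ∀ t' ∈ T, ∀ u ∈ U, ∀ u' ∈ U, t + u = t' + u' → t = t' ∧ u = u'

end

end CapitalAdequacy

namespace CapitalAdequacy

section Proof

variable {Ω : Type*} [MeasurableSpace Ω] {P : Measure Ω} {𝒳 : Submodule ℝ (LZero P)}

/-! Numéraire invariance lets gains and losses be rescaled separately, so only the location of the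
losses can matter. Scaling the gains of `X ∈ 𝒜` down to zero gives `min X 0 ∈ 𝒜` by closedness
(`represented_neg_negPart`), and convexity with scaling makes `𝒜` closed under addition. Call `B`
negligible if `-1_B ∈ 𝒜`. Negligible events are stable under countable unions, so there is an
essentially largest one (`exists_largest_isNegligible`); the required `A` is its complement. If `X ∈
𝒜`, multiples of `min X 0` show that each `{X < -1/(n+1)}` is negligible, so `X ≥ 0` a.s. on `A`
(`ae_nonneg`). Conversely, multiples of `-1_B` and a truncation limit make every loss on `B`
acceptable (`mem_of_ae_nonneg`). The topology enters only through convergence of a.s. decreasing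
sequences, which both kinds of ambient space share (`HasDecreasingLimits`). -/

/-- Some element of `S` is represented by the function `f`. -/
def Represented (S : Set 𝒳) (f : Ω → ℝ) : Prop :=
  ∃ X ∈ S, ((X : LZero P) : Ω → ℝ) =ᵐ[P] f

/-! ### Decreasing sequences in the two kinds of ambient space -/

/-- The ambient space contains the bounded random variables, and almost surely decreasing sequences
converge in it to their almost sure limits. -/
structure HasDecreasingLimits (𝒳 : Submodule ℝ (LZero P)) [TopologicalSpace 𝒳] : Prop where
  lInfty_le : LInfty P ≤ 𝒳
  tendsto : ∀ (X : ℕ → 𝒳) (Y : 𝒳), (∀ n, (X (n + 1) : LZero P) ≤ (X n : LZero P)) →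
    (∀ᵐ ω ∂P, Tendsto (fun n => (X n : LZero P) ω) atTop (𝓝 ((Y : LZero P) ω))) →
    Tendsto X atTop (𝓝 Y)

theorem IsFrechetLatticeSpace.hasDecreasingLimits [IsProbabilityMeasure P]
    [TopologicalSpace 𝒳] (h : IsFrechetLatticeSpace 𝒳) : HasDecreasingLimits 𝒳 where
  lInfty_le := h.lInfty_le
  tendsto X Y hX hlim := by
    have := h.isTopologicalAddGroup
    have key : Tendsto (fun n => X n - Y) atTop (𝓝 0) := by
      apply h.sigmaLebesgue
      · intro n
        have h1 := AEEqFun.coeFn_sub (X n : LZero P) (Y : LZero P)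
        have h2 := AEEqFun.coeFn_sub (X (n + 1) : LZero P) (Y : LZero P)
        refine AEEqFun.coeFn_le.1 ?_
        filter_upwards [h1, h2, AEEqFun.coeFn_le.2 (hX n)] with ω h1 h2 h3
        exact (h2.trans_le (sub_le_sub_right h3 _)).trans h1.ge
      · have hc : ∀ᵐ ω ∂P, ∀ n, ((X n - Y : 𝒳) : LZero P) ω
            = (X n : LZero P) ω - (Y : LZero P) ω := by
          rw [ae_all_iff]
          exact fun n => AEEqFun.coeFn_sub (X n : LZero P) (Y : LZero P)
        filter_upwards [hc, hlim] with ω h1 h2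
        simp only [h1]
        simpa using h2.sub_const ((Y : LZero P) ω)
    simpa using key.add_const Y

theorem LInfty.integrable_mul {X Z : LZero P} (hX : X ∈ LInfty P) (hZ : Integrable Z P) :
    Integrable (fun ω => X ω * Z ω) P := by
  have hX' : MemLp X ∞ P := Lp.mem_Lp_iff_memLp.1 hX
  exact hZ.mul_of_top_right hX'

/-- Dominated convergence against each `Z ∈ L¹`: monotonicity gives `Y ≤ X n ≤ X 0`, hence `|X n| ≤
|X 0| + |Y|`. -/
theorem hasDecreasingLimits_weakStar :
    @HasDecreasingLimits Ω _ P (LInfty P) (weakStarTopology (LInfty P)) := by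
  let _ := weakStarTopology (LInfty P)
  refine ⟨le_rfl, fun X Y hX hlim => ?_⟩
  rw [nhds_induced, tendsto_comap_iff, tendsto_pi_nhds]
  intro Z
  have hZ : Integrable (Z : LZero P) P := L1.integrable_coeFn Z
  refine tendsto_integral_of_dominated_convergence
    (fun ω => ‖(X 0 : LZero P) ω * (Z : LZero P) ω‖ + ‖(Y : LZero P) ω * (Z : LZero P) ω‖)
    (fun n => (LInfty.integrable_mul (X n).2 hZ).aestronglyMeasurable)
    ((LInfty.integrable_mul (X 0).2 hZ).norm.add (LInfty.integrable_mul Y.2 hZ).norm)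
    (fun n => ?_) ?_
  · have hmono : ∀ᵐ ω ∂P, ∀ n, (X (n + 1) : LZero P) ω ≤ (X n : LZero P) ω := by
      rw [ae_all_iff]
      exact fun n => AEEqFun.coeFn_le.2 (hX n)
    filter_upwards [hmono, hlim] with ω h1 h2
    have hanti : Antitone fun n => (X n : LZero P) ω := antitone_nat_of_succ_le h1
    have h3 := hanti (Nat.zero_le n)
    have h4 := hanti.le_of_tendsto h2 n
    simp only [Real.norm_eq_abs, abs_mul, ← add_mul]
    refine mul_le_mul_of_nonneg_right ?_ (abs_nonneg _)
    rw [abs_le]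
    constructor
    · linarith [neg_abs_le ((Y : LZero P) ω), abs_nonneg ((X 0 : LZero P) ω)]
    · linarith [le_abs_self ((X 0 : LZero P) ω), abs_nonneg ((Y : LZero P) ω)]
  · filter_upwards [hlim] with ω h
    exact h.mul_const _

theorem IsAmbientSpace.hasDecreasingLimits [IsProbabilityMeasure P] [τ : TopologicalSpace 𝒳]
    (h : IsAmbientSpace 𝒳) : HasDecreasingLimits 𝒳 := by
  rcases h with ⟨rfl, rfl⟩ | h
  · exact hasDecreasingLimits_weakStar
  · exact h.hasDecreasingLimits

/-! ### Pointwise representatives -/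

theorem mk_mem_lInfty {f : Ω → ℝ} (hf : AEStronglyMeasurable f P) {C : ℝ} (hC : ∀ ω, |f ω| ≤ C) :
    AEEqFun.mk f hf ∈ LInfty P := by
  refine Lp.mem_Lp_iff_memLp.2 ((memLp_congr_ae (AEEqFun.coeFn_mk f hf)).2 ?_)
  exact memLp_top_of_bound hf C (Eventually.of_forall hC)

theorem Represented.of_bounded (hle : LInfty P ≤ 𝒳) {f : Ω → ℝ} (hf : Measurable f) {C : ℝ}
    (hC : ∀ ω, |f ω| ≤ C) : Represented (Set.univ : Set 𝒳) f :=
  ⟨⟨_, hle (mk_mem_lInfty hf.aestronglyMeasurable hC)⟩, trivial, AEEqFun.coeFn_mk _ _⟩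

theorem Represented.mul_bounded (hmod : IsLInftyModule 𝒳) {f r : Ω → ℝ}
    (hf : Represented (Set.univ : Set 𝒳) f) (hr : Measurable r) {C : ℝ} (hC : ∀ ω, |r ω| ≤ C) :
    Represented (Set.univ : Set 𝒳) (fun ω => r ω * f ω) := by
  obtain ⟨X, -, hX⟩ := hf
  refine ⟨⟨_, hmod _ (mk_mem_lInfty hr.aestronglyMeasurable hC) X X.2⟩, trivial, ?_⟩
  filter_upwards [AEEqFun.coeFn_mul (AEEqFun.mk r hr.aestronglyMeasurable) (X : LZero P),
    AEEqFun.coeFn_mk r hr.aestronglyMeasurable, hX] with ω h1 h2 h3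
  simp [h1, h2, h3]

theorem Represented.congr {S : Set 𝒳} {f g : Ω → ℝ} (hf : Represented S f) (h : f =ᵐ[P] g) :
    Represented S g := by
  obtain ⟨X, hX, hXf⟩ := hf
  exact ⟨X, hX, hXf.trans h⟩

theorem represented_coe {S : Set 𝒳} {X : 𝒳} :
    Represented S (X : LZero P) ↔ X ∈ S := by
  refine ⟨fun ⟨Y, hY, h⟩ => ?_, fun h => ⟨X, h, ae_eq_rfl⟩⟩
  rwa [← Subtype.ext (AEEqFun.ext h)]

theorem Represented.mono {𝒜 : Set 𝒳} (hacc : IsAcceptanceSet 𝒜) {f g : Ω → ℝ}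
    (hf : Represented 𝒜 f) (hg : Represented (Set.univ : Set 𝒳) g) (h : f ≤ᵐ[P] g) :
    Represented 𝒜 g := by
  obtain ⟨X, hX, hXf⟩ := hf
  obtain ⟨Y, -, hYg⟩ := hg
  refine ⟨Y, hacc.monotone X hX Y (AEEqFun.coeFn_le.1 ?_), hYg⟩
  exact hXf.trans_le (h.trans hYg.symm.le)

/-- The form in which closedness of `𝒜` is used throughout. -/
theorem Represented.of_decreasing [TopologicalSpace 𝒳] (h𝒳 : HasDecreasingLimits 𝒳)
    {𝒜 : Set 𝒳} (hclosed : IsClosed 𝒜) {f : ℕ → Ω → ℝ} {g : Ω → ℝ}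
    (hf : ∀ n, Represented 𝒜 (f n)) (hg : Represented (Set.univ : Set 𝒳) g)
    (hanti : ∀ n ω, f (n + 1) ω ≤ f n ω)
    (hlim : ∀ ω, Tendsto (fun n => f n ω) atTop (𝓝 (g ω))) : Represented 𝒜 g := by
  choose X hX hXf using hf
  obtain ⟨Y, -, hYg⟩ := hg
  refine ⟨Y, hclosed.mem_of_tendsto (h𝒳.tendsto X Y (fun n => ?_) ?_)
    (Eventually.of_forall hX), hYg⟩
  · rw [← AEEqFun.coeFn_le]
    filter_upwards [hXf n, hXf (n + 1)] with ω h1 h2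
    rw [h1, h2]
    exact hanti n ω
  · filter_upwards [ae_all_iff.2 hXf, hYg] with ω h1 h2
    simp only [h1, h2]
    exact hlim ω

/-! ### Rescaling of losses and negligible events -/

/-- An event is negligible for `𝒜` when a unit loss on it is acceptable. -/
def IsNegligible (𝒜 : Set 𝒳) (B : Set Ω) : Prop :=
  MeasurableSet B ∧ Represented 𝒜 (fun ω => -B.indicator (fun _ => (1 : ℝ)) ω)

theorem represented_neg_indicator (hle : LInfty P ≤ 𝒳) {B : Set Ω} (hB : MeasurableSet B) :
    Represented (Set.univ : Set 𝒳) (fun ω => -B.indicator (fun _ => (1 : ℝ)) ω) := by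
  refine Represented.of_bounded hle (measurable_const.indicator hB).neg (C := 1) fun ω => ?_
  by_cases h : ω ∈ B <;> simp [h]

section NumeraireInvariant

variable {hmod : IsLInftyModule 𝒳} {𝒜 : Set 𝒳}

theorem IsNumeraireInvariant.represented_mul (hinv : IsNumeraireInvariant hmod 𝒜)
    {f r : Ω → ℝ} (hf : Represented 𝒜 f) (hr : Measurable r) (hpos : ∀ ω, 0 < r ω) {C : ℝ}
    (hC : ∀ ω, r ω ≤ C) : Represented 𝒜 (fun ω => r ω * f ω) := by
  obtain ⟨X, hX, hXf⟩ := hf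
  have hae := AEEqFun.coeFn_mk r (hr.aestronglyMeasurable (μ := P))
  refine ⟨_, hinv (AEEqFun.mk r hr.aestronglyMeasurable)
    ⟨mk_mem_lInfty _ fun ω => (abs_of_pos (hpos ω)).trans_le (hC ω), ?_⟩ X hX, ?_⟩
  · filter_upwards [hae] with ω h
    rw [h]
    exact hpos ω
  · filter_upwards [AEEqFun.coeFn_mul (AEEqFun.mk r hr.aestronglyMeasurable) (X : LZero P),
      hae, hXf] with ω h1 h2 h3
    simp [h1, h2, h3]

theorem IsNumeraireInvariant.represented_add (hinv : IsNumeraireInvariant hmod 𝒜)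
    (hconvex : Convex ℝ 𝒜) {f g : Ω → ℝ} (hf : Represented 𝒜 f) (hg : Represented 𝒜 g) :
    Represented 𝒜 (fun ω => f ω + g ω) := by
  -- The factor `2` cancels the weight `1/2` of the convex combination.
  obtain ⟨X, hX, hXf⟩ := hinv.represented_mul hf (measurable_const (a := (2 : ℝ)))
    (fun _ => two_pos) (fun _ => le_rfl)
  obtain ⟨Y, hY, hYg⟩ := hinv.represented_mul hg (measurable_const (a := (2 : ℝ)))
    (fun _ => two_pos) (fun _ => le_rfl)
  refine ⟨_, hconvex hX hY (a := 1 / 2) (b := 1 / 2) (by norm_num) (by norm_num)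
    (by norm_num), ?_⟩
  filter_upwards [hXf, hYg, AEEqFun.coeFn_smul (1 / 2 : ℝ) (X : LZero P),
    AEEqFun.coeFn_smul (1 / 2 : ℝ) (Y : LZero P),
    AEEqFun.coeFn_add ((1 / 2 : ℝ) • (X : LZero P)) ((1 / 2 : ℝ) • (Y : LZero P))]
    with ω h1 h2 h3 h4 h5
  simp only [Submodule.coe_add, Submodule.coe_smul, h5, Pi.add_apply, h3, h4, Pi.smul_apply,
    smul_eq_mul, h1, h2]
  ring

variable [TopologicalSpace 𝒳]

/-- Scaling down the gains of an acceptable position leaves its losses acceptable. -/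
theorem IsNumeraireInvariant.represented_neg_negPart (hinv : IsNumeraireInvariant hmod 𝒜)
    (h𝒳 : HasDecreasingLimits 𝒳) (hclosed : IsClosed 𝒜) {f : Ω → ℝ} (hm : Measurable f)
    (hf : Represented 𝒜 f) : Represented 𝒜 (fun ω => min (f ω) 0) := by
  have hset : MeasurableSet {ω | f ω < 0} := measurableSet_lt hm measurable_const
  have hone (n : ℕ) : (1 : ℝ) / (n + 1) ≤ 1 := by
    rw [div_le_one (by positivity)]
    linarith [n.cast_nonneg (α := ℝ)]
  classical
  -- The factors decrease to the indicator of `{f < 0}`, which is not itself strictly positive; this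
  -- is why a limit is needed.
  refine Represented.of_decreasing h𝒳 hclosed
    (f := fun n ω => (if f ω < 0 then 1 else 1 / ((n : ℝ) + 1)) * f ω)
    (fun n => hinv.represented_mul hf (Measurable.ite hset measurable_const measurable_const)
      (fun ω => ?_) (C := 1) fun ω => ?_) ?_ (fun n ω => ?_) fun ω => ?_
  · split_ifs <;> positivity
  · split_ifs
    exacts [le_rfl, hone n]
  · obtain ⟨X, -, hX⟩ := hf
    refine (Represented.mul_bounded hmod (f := f) ⟨X, trivial, hX⟩
      (r := fun ω => if f ω < 0 then 1 else 0) (C := 1)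
      (Measurable.ite hset measurable_const measurable_const)
      fun ω => ?_).congr (Eventually.of_forall fun ω => ?_)
    · split_ifs <;> simp
    · by_cases h : f ω < 0
      · simp [h, h.le]
      · simp [h, not_lt.1 h]
  · by_cases h : f ω < 0
    · simp [h]
    · simp only [h, if_false]
      refine mul_le_mul_of_nonneg_right (one_div_le_one_div_of_le (by positivity) ?_) (not_lt.1 h)
      push_cast
      linarith
  · by_cases h : f ω < 0
    · simp [h, h.le]
    · simpa [h, not_lt.1 h] using
        (tendsto_one_div_add_atTop_nhds_zero_nat (𝕜 := ℝ)).mul_const (f ω)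

theorem IsNumeraireInvariant.represented_zero (hinv : IsNumeraireInvariant hmod 𝒜)
    (h𝒳 : HasDecreasingLimits 𝒳) (hclosed : IsClosed 𝒜) (hacc : IsAcceptanceSet 𝒜) :
    Represented 𝒜 (fun _ => 0) := by
  obtain ⟨X, hX⟩ := hacc.nonempty
  have hm : Measurable ((X : LZero P) : Ω → ℝ) := AEEqFun.measurable _
  exact Represented.mono hacc
    (hinv.represented_neg_negPart h𝒳 hclosed hm (represented_coe.2 hX))
    (Represented.of_bounded h𝒳.lInfty_le measurable_const (C := 0) fun _ => by simp)
    (Eventually.of_forall fun ω => min_le_right _ _)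

/-- Monotonicity applies because `-1_B - 1_C ≤ -1_{B ∪ C}`. -/
theorem IsNegligible.union (hinv : IsNumeraireInvariant hmod 𝒜) (h𝒳 : HasDecreasingLimits 𝒳)
    (hacc : IsAcceptanceSet 𝒜) (hconvex : Convex ℝ 𝒜) {B C : Set Ω} (hB : IsNegligible 𝒜 B)
    (hC : IsNegligible 𝒜 C) : IsNegligible 𝒜 (B ∪ C) := by
  refine ⟨hB.1.union hC.1, Represented.mono hacc (hinv.represented_add hconvex hB.2 hC.2)
    (represented_neg_indicator h𝒳.lInfty_le (hB.1.union hC.1))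
    (Eventually.of_forall fun ω => ?_)⟩
  by_cases h1 : ω ∈ B <;> by_cases h2 : ω ∈ C <;> simp [h1, h2]

theorem IsNegligible.iUnion (hinv : IsNumeraireInvariant hmod 𝒜) (h𝒳 : HasDecreasingLimits 𝒳)
    (hacc : IsAcceptanceSet 𝒜) (hclosed : IsClosed 𝒜) (hconvex : Convex ℝ 𝒜) {B : ℕ → Set Ω}
    (hB : ∀ n, IsNegligible 𝒜 (B n)) : IsNegligible 𝒜 (⋃ n, B n) := by
  have hacc' (n : ℕ) : IsNegligible 𝒜 (Set.accumulate B n) := by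
    induction n with
    | zero => simpa using hB 0
    | succ n ih =>
      rw [Set.accumulate_succ]
      exact ih.union hinv h𝒳 hacc hconvex (hB _)
  have hm := MeasurableSet.iUnion fun n => (hB n).1
  refine ⟨hm, Represented.of_decreasing h𝒳 hclosed (fun n => (hacc' n).2)
    (represented_neg_indicator h𝒳.lInfty_le hm) (fun n ω => ?_) fun ω => ?_⟩
  · exact neg_le_neg (Set.indicator_le_indicator_of_subset
      (Set.monotone_accumulate n.le_succ) (fun _ => zero_le_one) ω)
  · rw [← Set.iUnion_accumulate]
    exact ((Set.monotone_accumulate.tendsto_indicator _ _ _).mono_right (pure_le_nhds _)).neg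

/-- There is an essentially largest negligible event. -/
theorem exists_largest_isNegligible [IsProbabilityMeasure P] (hinv : IsNumeraireInvariant hmod 𝒜)
    (h𝒳 : HasDecreasingLimits 𝒳) (hacc : IsAcceptanceSet 𝒜) (hclosed : IsClosed 𝒜)
    (hconvex : Convex ℝ 𝒜) :
    ∃ B, IsNegligible 𝒜 B ∧ ∀ C, IsNegligible 𝒜 C → C ≤ᵐ[P] B := by
  have hne : (P '' {B | IsNegligible 𝒜 B}).Nonempty :=
    ⟨_, ∅, ⟨MeasurableSet.empty, by simpa using hinv.represented_zero h𝒳 hclosed hacc⟩, rfl⟩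
  obtain ⟨u, -, hu, hmem⟩ := exists_seq_tendsto_sSup hne (OrderTop.bddAbove _)
  choose B hB hBu using hmem
  have hneg := IsNegligible.iUnion hinv h𝒳 hacc hclosed hconvex hB
  -- The union of a maximizing sequence attains the supremum of the probabilities, so adjoining `C`
  -- cannot increase its measure.
  refine ⟨⋃ n, B n, hneg, fun C hC => ?_⟩
  have hle : P ((⋃ n, B n) ∪ C) ≤ P (⋃ n, B n) :=
    (le_sSup (Set.mem_image_of_mem P (hneg.union hinv h𝒳 hacc hconvex hC))).trans
      (le_of_tendsto' hu fun n => (hBu n).symm.trans_le (measure_mono (Set.subset_iUnion B n)))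
  have hae := ae_eq_of_subset_of_measure_ge Set.subset_union_left hle
    hneg.1.nullMeasurableSet (measure_ne_top _ _)
  exact (LE.le.eventuallyLE Set.subset_union_right).trans hae.symm.le

/-- The losses of an acceptable position are supported by the largest negligible event. -/
theorem IsNumeraireInvariant.ae_nonneg (hinv : IsNumeraireInvariant hmod 𝒜)
    (h𝒳 : HasDecreasingLimits 𝒳) (hacc : IsAcceptanceSet 𝒜) (hclosed : IsClosed 𝒜) {B : Set Ω}
    (hB : ∀ C, IsNegligible 𝒜 C → C ≤ᵐ[P] B) {X : 𝒳} (hX : X ∈ 𝒜) :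
    ∀ᵐ ω ∂P, ω ∉ B → 0 ≤ (X : LZero P) ω := by
  have hm : Measurable ((X : LZero P) : Ω → ℝ) := AEEqFun.measurable _
  -- On this event `(n + 1) * min X 0 ≤ -1`, so its negative indicator dominates an acceptable
  -- position.
  have key (n : ℕ) : {ω | (X : LZero P) ω < -(1 / ((n : ℝ) + 1))} ≤ᵐ[P] B := by
    have hset := measurableSet_lt hm (measurable_const (a := -(1 / ((n : ℝ) + 1))))
    refine hB _ ⟨hset, Represented.mono hacc
      (hinv.represented_mul
        (hinv.represented_neg_negPart h𝒳 hclosed hm (represented_coe.2 hX))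
        (measurable_const (a := (n : ℝ) + 1)) (fun _ => by positivity) fun _ => le_rfl)
      (represented_neg_indicator h𝒳.lInfty_le hset) (Eventually.of_forall fun ω => ?_)⟩
    have hn : (0 : ℝ) < n + 1 := by positivity
    by_cases h : (X : LZero P) ω < -(1 / ((n : ℝ) + 1))
    · simp only [Set.indicator, Set.mem_ofPred_eq, h, if_true]
      calc ((n : ℝ) + 1) * min ((X : LZero P) ω) 0 ≤ (n + 1) * -(1 / ((n : ℝ) + 1)) :=
            mul_le_mul_of_nonneg_left ((min_le_left _ _).trans h.le) hn.le
        _ = -1 := by field_simp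
    · simp only [Set.indicator, Set.mem_ofPred_eq, h, if_false, neg_zero]
      exact mul_nonpos_of_nonneg_of_nonpos hn.le (min_le_right _ _)
  filter_upwards [ae_all_iff.2 key] with ω h hω
  by_contra! hneg
  obtain ⟨n, hn⟩ := exists_nat_one_div_lt (neg_pos.2 hneg)
  exact hω (h n (show _ < _ by linarith))

/-- Every position without losses outside a negligible event is acceptable. -/
theorem IsNumeraireInvariant.mem_of_ae_nonneg (hinv : IsNumeraireInvariant hmod 𝒜)
    (h𝒳 : HasDecreasingLimits 𝒳) (hacc : IsAcceptanceSet 𝒜) (hclosed : IsClosed 𝒜) {B : Set Ω}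
    (hB : IsNegligible 𝒜 B) {X : 𝒳} (hX : ∀ᵐ ω ∂P, ω ∉ B → 0 ≤ (X : LZero P) ω) : X ∈ 𝒜 := by
  have hm : Measurable ((X : LZero P) : Ω → ℝ) := AEEqFun.measurable _
  have hrep : Represented (Set.univ : Set 𝒳) (X : LZero P) := represented_coe.2 trivial
  -- The limit `-1_B X⁻` lies in `𝒳` because it is `X` times the indicator of `B ∩ {X < 0}`.
  have hneg : Represented (Set.univ : Set 𝒳)
      (fun ω => -B.indicator (fun _ => max (-(X : LZero P) ω) 0) ω) := by
    have hset : MeasurableSet (B ∩ {ω | (X : LZero P) ω < 0}) :=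
      hB.1.inter (measurableSet_lt hm measurable_const)
    refine (hrep.mul_bounded hmod ((measurable_const (a := (1 : ℝ))).indicator hset) (C := 1)
      fun ω => ?_).congr (Eventually.of_forall fun ω => ?_)
    · simp only [Set.indicator]
      split_ifs <;> simp
    · by_cases h1 : ω ∈ B
      · by_cases h2 : (X : LZero P) ω < 0
        · simp [h1, h2, h2.le]
        · simp [h1, h2, not_lt.1 h2]
      · simp [h1]
  rw [← represented_coe (S := 𝒜)]
  -- Truncating the loss at `n + 1` keeps it above the acceptable position `-(n + 1) 1_B`. The
  -- truncations decrease to `-1_B X⁻`, which is at most `X`.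
  refine Represented.mono hacc (Represented.of_decreasing h𝒳 hclosed
    (f := fun n ω => -B.indicator (fun _ => min (max (-(X : LZero P) ω) 0) ((n : ℝ) + 1)) ω)
    (fun n => ?_) hneg (fun n ω => ?_) fun ω => ?_) hrep ?_
  · have hn : (0 : ℝ) < n + 1 := by positivity
    refine Represented.mono hacc (hinv.represented_mul hB.2
      (measurable_const (a := (n : ℝ) + 1)) (fun _ => hn) fun _ => le_rfl)
      (Represented.of_bounded h𝒳.lInfty_le (Measurable.neg ?_) (C := (n : ℝ) + 1) fun ω => ?_)
      (Eventually.of_forall fun ω => ?_)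
    · exact ((hm.neg.max measurable_const).min measurable_const).indicator hB.1
    · by_cases h : ω ∈ B
      · simp only [Set.indicator, h, if_true, abs_neg]
        rw [abs_of_nonneg (le_min (le_max_right _ _) hn.le)]
        exact min_le_right _ _
      · simpa [h] using hn.le
    · by_cases h : ω ∈ B <;> simp [h]
  · by_cases h : ω ∈ B
    · simp only [Set.indicator, h, if_true]
      refine neg_le_neg (min_le_min le_rfl ?_)
      push_cast
      linarith
    · simp [h]
  · refine tendsto_const_nhds.congr' ?_
    obtain ⟨N, hN⟩ := exists_nat_ge (max (-(X : LZero P) ω) 0)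
    filter_upwards [eventually_ge_atTop N] with n hn
    have : max (-(X : LZero P) ω) 0 ≤ (n : ℝ) + 1 := by
      have : (N : ℝ) ≤ n := by exact_mod_cast hn
      linarith
    by_cases h : ω ∈ B
    · simp only [Set.indicator, h, if_true, min_eq_left this]
    · simp [h]
  · filter_upwards [hX] with ω h
    by_cases hω : ω ∈ B
    · simp only [Set.indicator, hω, if_true]
      linarith [le_max_left (-(X : LZero P) ω) 0]
    · simpa [hω] using h hω

end NumeraireInvariant

/-! ### The direct sum as a pointwise sign condition -/

theorem coeFn_ind_mul {A : Set Ω} (hA : MeasurableSet A) (X : LZero P) :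
    (ind P hA * X : LZero P) =ᵐ[P] A.indicator X := by
  have h : (ind P hA : Ω → ℝ) =ᵐ[P] A.indicator fun _ => (1 : ℝ) := AEEqFun.coeFn_mk _ _
  filter_upwards [AEEqFun.coeFn_mul (ind P hA) X, h] with ω h1 h2
  rw [h1, Pi.mul_apply, h2]
  by_cases hω : ω ∈ A <;> simp [hω]

theorem ind_mem_lInfty {A : Set Ω} (hA : MeasurableSet A) : ind P hA ∈ LInfty P := by
  refine mk_mem_lInfty _ (C := 1) fun ω => ?_
  by_cases h : ω ∈ A <;> simp [h]

theorem mem_restrict_iff {A : Set Ω} (hA : MeasurableSet A) {Y : 𝒳} :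
    Y ∈ restrict 𝒳 hA ↔ ∀ᵐ ω ∂P, ω ∉ A → (Y : LZero P) ω = 0 := by
  constructor
  · rintro ⟨X, hX⟩
    rw [hX]
    filter_upwards [coeFn_ind_mul hA (X : LZero P)] with ω h hω
    rw [h, Set.indicator_of_notMem hω]
  · intro h
    refine ⟨Y, AEEqFun.ext ?_⟩
    filter_upwards [h, coeFn_ind_mul hA (Y : LZero P)] with ω h1 h2
    rw [h2]
    by_cases hω : ω ∈ A
    · simp [hω]
    · simp [hω, h1 hω]

theorem zero_le_iff_ae {X : LZero P} : 0 ≤ X ↔ ∀ᵐ ω ∂P, 0 ≤ X ω := by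
  rw [← AEEqFun.coeFn_le]
  have h0 : ((0 : LZero P) : Ω → ℝ) =ᵐ[P] 0 := AEEqFun.coeFn_zero
  constructor <;> intro h <;> filter_upwards [h, h0] with ω h1 h2
  · simpa [h2] using h1
  · simpa [h2] using h1

/-- The decomposition is `X = 1_A X + 1_{Aᶜ} X`, available in `𝒳` by the module property. -/
theorem mem_restrictPos_add_restrict_iff (hmod : IsLInftyModule 𝒳) {A : Set Ω}
    (hA : MeasurableSet A) {X : 𝒳} :
    X ∈ restrictPos 𝒳 hA + restrict 𝒳 hA.compl ↔ ∀ᵐ ω ∂P, ω ∈ A → 0 ≤ (X : LZero P) ω := by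
  constructor
  · rintro ⟨Y, ⟨-, hY⟩, Z, hZ, rfl⟩
    filter_upwards [zero_le_iff_ae.1 hY, (mem_restrict_iff _).1 hZ,
      AEEqFun.coeFn_add (Y : LZero P) (Z : LZero P)] with ω h1 h2 h3 hω
    simpa [h3, h2 (not_not.2 hω)] using h1
  · intro h
    refine ⟨⟨_, hmod _ (ind_mem_lInfty hA) X X.2⟩, ⟨⟨X, rfl⟩, zero_le_iff_ae.2 ?_⟩,
      ⟨_, hmod _ (ind_mem_lInfty hA.compl) X X.2⟩, ⟨X, rfl⟩, Subtype.ext (AEEqFun.ext ?_)⟩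
    · filter_upwards [h, coeFn_ind_mul hA (X : LZero P)] with ω h1 h2
      rw [h2]
      by_cases hω : ω ∈ A
      · simpa [hω] using h1 hω
      · simp [hω]
    · filter_upwards [coeFn_ind_mul hA (X : LZero P), coeFn_ind_mul hA.compl (X : LZero P),
        AEEqFun.coeFn_add (ind P hA * (X : LZero P)) (ind P hA.compl * (X : LZero P))]
        with ω h1 h2 h3
      simp only [Submodule.coe_add]
      rw [h3, Pi.add_apply, h1, h2]
      by_cases hω : ω ∈ A <;> simp [hω]

/-- On `A` the second summands vanish, and off `A` the first ones do. -/
theorem restrict_decomposition_unique {A : Set Ω} (hA : MeasurableSet A) {Y Y' Z Z' : 𝒳}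
    (hY : Y ∈ restrict 𝒳 hA) (hY' : Y' ∈ restrict 𝒳 hA) (hZ : Z ∈ restrict 𝒳 hA.compl)
    (hZ' : Z' ∈ restrict 𝒳 hA.compl) (h : Y + Z = Y' + Z') : Y = Y' ∧ Z = Z' := by
  have hYY : Y = Y' := by
    refine Subtype.ext (AEEqFun.ext ?_)
    have h0 : ((Y : LZero P) + (Z : LZero P)) = (Y' : LZero P) + (Z' : LZero P) :=
      congrArg Subtype.val h
    have h1 := AEEqFun.coeFn_add (Y : LZero P) (Z : LZero P)
    rw [h0] at h1
    filter_upwards [h1, AEEqFun.coeFn_add (Y' : LZero P) (Z' : LZero P),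
      (mem_restrict_iff _).1 hY, (mem_restrict_iff _).1 hY', (mem_restrict_iff _).1 hZ,
      (mem_restrict_iff _).1 hZ'] with ω e1 e2 e3 e4 e5 e6
    by_cases hω : ω ∈ A
    · have h5 := e5 (not_not.2 hω)
      have h6 := e6 (not_not.2 hω)
      rw [e1] at e2
      simpa [h5, h6] using e2
    · rw [e3 hω, e4 hω]
  subst hYY
  exact ⟨rfl, add_left_cancel h⟩

theorem isDirectSum_restrictPos_restrict_iff (hmod : IsLInftyModule 𝒳) {A : Set Ω}
    (hA : MeasurableSet A) {𝒜 : Set 𝒳} :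
    IsDirectSum 𝒜 (restrictPos 𝒳 hA) (restrict 𝒳 hA.compl) ↔
      ∀ X : 𝒳, X ∈ 𝒜 ↔ ∀ᵐ ω ∂P, ω ∈ A → 0 ≤ (X : LZero P) ω := by
  simp_rw [← mem_restrictPos_add_restrict_iff hmod hA]
  refine ⟨fun h X => by rw [h.1], fun h => ⟨Set.ext h, ?_⟩⟩
  intro Y hY Y' hY' Z hZ Z' hZ' heq
  exact restrict_decomposition_unique hA hY.1 hY'.1 hZ hZ' heq

end Proof

end CapitalAdequacy

/-! ### The characterization -/

open CapitalAdequacy in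
theorem mainTheorem4 {Ω : Type*} [MeasurableSpace Ω] (P : Measure Ω) [IsProbabilityMeasure P]
    (𝒳 : Submodule ℝ (CapitalAdequacy.LZero P)) [TopologicalSpace 𝒳]
    (h𝒳 : CapitalAdequacy.IsAmbientSpace 𝒳)
    (hmod : CapitalAdequacy.IsLInftyModule 𝒳)
    (𝒜 : Set 𝒳) (hacc : CapitalAdequacy.IsAcceptanceSet 𝒜)
    (hclosed : IsClosed 𝒜) (hconvex : Convex ℝ 𝒜) :
    CapitalAdequacy.IsNumeraireInvariant hmod 𝒜 ↔
      ∃ (A : Set Ω) (hA : MeasurableSet A), 0 < P A ∧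
        CapitalAdequacy.IsDirectSum 𝒜
          (CapitalAdequacy.restrictPos 𝒳 hA) (CapitalAdequacy.restrict 𝒳 hA.compl) := by
  have hlim := h𝒳.hasDecreasingLimits
  simp_rw [isDirectSum_restrictPos_restrict_iff hmod]
  constructor
  · intro hinv
    obtain ⟨B, hB, hmax⟩ := exists_largest_isNegligible hinv hlim hacc hclosed hconvex
    have hiff (X : 𝒳) : X ∈ 𝒜 ↔ ∀ᵐ ω ∂P, ω ∈ Bᶜ → 0 ≤ (X : LZero P) ω :=
      ⟨hinv.ae_nonneg hlim hacc hclosed hmax, hinv.mem_of_ae_nonneg hlim hacc hclosed hB⟩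
    -- If `Bᶜ` were null, the sign condition would be void and `𝒜` would be all of `𝒳`.
    refine ⟨Bᶜ, hB.1.compl, pos_iff_ne_zero.2 fun h0 => hacc.ne_univ ?_, hiff⟩
    refine Set.eq_univ_of_forall fun X => (hiff X).2 ?_
    filter_upwards [measure_eq_zero_iff_ae_notMem.1 h0] with ω h hω
    exact absurd hω h
  · rintro ⟨A, hA, -, hiff⟩ R hR X hX
    rw [hiff] at hX ⊢
    filter_upwards [hX, hR.2, AEEqFun.coeFn_mul R (X : LZero P)] with ω h1 h2 h3 hω
    rw [h3]
    exact mul_nonneg h2.le (h1 hω)
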